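/- Let $k\in L_1(\mathbb{R})$ be a complex-valued function satisfying Wiener's condition: its Fourier transform satisfies $\hat{k}(t)\neq 0$ for every $t\in\mathbb{R}$. For $f\in L_\infty(\mathbb{R})$ put $(k*f)(x)=\int_{\mathbb{R}}k(t)f(x-t)\,dt$, $x\in\mathbb{R}$. Then this integral converges absolutely for every $f\in L_\infty(\mathbb{R})$ and every $x\in\mathbb{R}$, and $\{k*f : f\in L_\infty(\mathbb{R})\}$ is a dense subset of $C_{b,u}(\mathbb{R})$, the space of bounded uniformly continuous functions $\mathbb{R}\to\mathbb{C}$ with the supremum norm. -/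

import Mathlib

open MeasureTheory
open scoped ENNReal Convolution FourierTransform BoundedContinuousFunction

/-- The space `C_{b,u}(ℝ)` of bounded uniformly continuous functions `ℝ → ℂ`, as a subspace of the
bounded continuous functions; its norm and topology are those of the supremum norm. -/
def BoundedUniformlyContinuous : Submodule ℂ (ℝ →ᵇ ℂ) where
  carrier := {g | UniformContinuous (g : ℝ → ℂ)}
  zero_mem' := uniformContinuous_const
  add_mem' := fun hf hg => UniformContinuous.add hf hg
  smul_mem' := fun c _ hg => UniformContinuous.const_smul hg c

/-- The set `{k * f : f ∈ L_∞(ℝ)}` of functions `ℝ → ℂ`, where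
`(k * f)(x) = ∫ k(t) f(x - t) dt` is the convolution with respect to Lebesgue measure. -/
def convolutionsWithBounded (k : ℝ → ℂ) : Set (ℝ → ℂ) :=
  {h | ∃ f : ℝ → ℂ, MemLp f ∞ volume ∧ h = k ⋆[ContinuousLinearMap.mul ℂ ℂ, volume] f}

section WienerTauberian

open Filter Topology Real
open scoped ContDiff

/-! Kernels act by convolution as commuting operators in the Banach algebra of bounded operators on
`ℝ →ᵇ ℂ`, and Wiener's division is carried out there. Local step: let `W` be integrable with
transform a narrow bump equal to `1` near `a`. Then `k * W` is close to `𝓕 k a • W` in operator norm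
(`norm_convOp_modDilate_le`), so since `𝓕 k a ≠ 0` a Neumann series divides by `k` every kernel
whose transform lives near `a` (`exists_mul_eq_of_norm_sub_smul_lt`, `exists_pos_convDivides`).
Compactness and smooth cutoffs extend this to every kernel with smooth compactly supported transform
(`convDivides_fourierInv`). Such kernels include an approximate identity, which converges uniformly
on uniformly continuous `g` (`exists_norm_convOp_modDilate_sub_lt`); hence `g` is a uniform limit of
functions `k * f`, even with `f` continuous. -/

/-! ### Translation in L¹ and convolution with bounded functions -/

theorem continuous_integral_norm_translate_sub {k : ℝ → ℂ} (hk : Integrable k) :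
    Continuous fun s : ℝ => ∫ x, ‖k (s + x) - k x‖ := by
  have hk1 : MemLp k 1 volume := memLp_one_iff_integrable.2 hk
  have : Fact ((1 : ℝ≥0∞) ≠ ⊤) := ⟨ENNReal.one_ne_top⟩
  have key : ∀ s : ℝ, ∫ x, ‖k (s + x) - k x‖ =
      ‖(DomAddAct.mk s +ᵥ hk1.toLp k : Lp ℂ 1 volume) - hk1.toLp k‖ := by
    intro s
    rw [L1.norm_eq_integral_norm]
    apply integral_congr_ae
    filter_upwards [Lp.coeFn_sub (DomAddAct.mk s +ᵥ hk1.toLp k : Lp ℂ 1 volume) (hk1.toLp k),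
      hk1.coeFn_toLp, DomAddAct.vadd_Lp_ae_eq (DomAddAct.mk s) (hk1.toLp k),
      (measurePreserving_add_left volume s).quasiMeasurePreserving.ae hk1.coeFn_toLp]
      with x h1 h2 h3 h4
    rw [h1, Pi.sub_apply, h2, h3]
    simp only [Equiv.symm_apply_apply, vadd_eq_add]
    rw [h4]
  simp_rw [key]
  have : Continuous fun s : ℝ => (DomAddAct.mk s) := DomAddAct.continuous_mk
  exact ((this.vadd continuous_const).sub continuous_const).norm

theorem integral_norm_translate_sub_le {k : ℝ → ℂ} (hk : Integrable k) (s : ℝ) :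
    ∫ x, ‖k (s + x) - k x‖ ≤ 2 * ∫ x, ‖k x‖ := by
  have h1 : Integrable fun x => k (s + x) := hk.comp_add_left s
  calc ∫ x, ‖k (s + x) - k x‖ ≤ ∫ x, (‖k (s + x)‖ + ‖k x‖) :=
        integral_mono (h1.sub hk).norm (h1.norm.add hk.norm) fun x => norm_sub_le _ _
    _ = 2 * ∫ x, ‖k x‖ := by
        rw [integral_add h1.norm hk.norm, integral_add_left_eq_self (fun x => ‖k x‖) s, two_mul]

theorem MeasureTheory.MemLp.exists_ae_norm_le {f : ℝ → ℂ} (hf : MemLp f ∞ volume) :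
    ∃ C : ℝ, 0 ≤ C ∧ ∀ᵐ x, ‖f x‖ ≤ C := by
  refine ⟨(eLpNorm f ∞ volume).toReal, ENNReal.toReal_nonneg, ?_⟩
  filter_upwards [ae_le_eLpNormEssSup (f := f) (μ := volume)] with x hx
  rw [← toReal_enorm]
  exact ENNReal.toReal_mono hf.2.ne (by simpa using hx)

theorem MeasureTheory.Integrable.mul_translate_memLp_top {k f : ℝ → ℂ} (hk : Integrable k)
    (hf : MemLp f ∞ volume) (x : ℝ) : Integrable fun t => k t * f (x - t) := by
  obtain ⟨C, -, hC⟩ := hf.exists_ae_norm_le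
  have hq := (Measure.measurePreserving_sub_left (volume : Measure ℝ) x).quasiMeasurePreserving
  exact hk.mul_bdd (hf.1.comp_quasiMeasurePreserving hq) (hq.ae hC)

theorem convolutionExists_of_memLp_top {k f : ℝ → ℂ} (hk : Integrable k)
    (hf : MemLp f ∞ volume) :
    ConvolutionExists k f (ContinuousLinearMap.mul ℂ ℂ) volume :=
  fun x => hk.mul_translate_memLp_top hf x

theorem norm_convolution_le {k f : ℝ → ℂ} (hk : Integrable k) {C : ℝ}
    (hf : MemLp f ∞ volume) (hC : ∀ᵐ x, ‖f x‖ ≤ C) (x : ℝ) :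
    ‖∫ t, k t * f (x - t)‖ ≤ C * ∫ t, ‖k t‖ := by
  have hq := (Measure.measurePreserving_sub_left (volume : Measure ℝ) x).quasiMeasurePreserving
  calc ‖∫ t, k t * f (x - t)‖ ≤ ∫ t, ‖k t * f (x - t)‖ := norm_integral_le_integral_norm _
    _ ≤ ∫ t, C * ‖k t‖ := by
        refine integral_mono_ae (hk.mul_translate_memLp_top hf x).norm (hk.norm.const_mul C) ?_
        filter_upwards [hq.ae hC] with t ht
        rw [norm_mul, mul_comm]
        gcongr
    _ = _ := integral_const_mul _ _

/-- Translation invariance moves the shift from `f` to `k`, so L¹-continuity of translation gives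
uniform continuity for merely bounded `f`. -/
theorem norm_convolution_sub_le {k f : ℝ → ℂ} (hk : Integrable k) {C : ℝ}
    (hf : MemLp f ∞ volume) (hC : ∀ᵐ x, ‖f x‖ ≤ C) (x y : ℝ) :
    ‖(∫ t, k t * f (x - t)) - ∫ t, k t * f (y - t)‖ ≤
      C * ∫ t, ‖k ((x - y) + t) - k t‖ := by
  have hs : Integrable fun t => k ((x - y) + t) := hk.comp_add_left _
  have h : ∫ t, k t * f (x - t) = ∫ t, k ((x - y) + t) * f (y - t) := by
    rw [← integral_add_left_eq_self (fun t => k t * f (x - t)) (x - y)]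
    congr 1 with t
    congr 2
    ring
  rw [h, ← integral_sub (hs.mul_translate_memLp_top hf y) (hk.mul_translate_memLp_top hf y)]
  simp_rw [← sub_mul]
  exact norm_convolution_le (hs.sub hk) hf hC y

theorem uniformContinuous_convolution {k f : ℝ → ℂ} (hk : Integrable k)
    (hf : MemLp f ∞ volume) : UniformContinuous fun x => ∫ t, k t * f (x - t) := by
  obtain ⟨C, hC0, hC⟩ := hf.exists_ae_norm_le
  rw [Metric.uniformContinuous_iff]
  intro ε hε
  have hcont := (continuous_integral_norm_translate_sub hk).const_mul C
  obtain ⟨δ, hδ, h⟩ := Metric.continuous_iff.1 hcont 0 ε hε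
  refine ⟨δ, hδ, fun x y hxy => ?_⟩
  rw [dist_eq_norm]
  refine (norm_convolution_sub_le hk hf hC x y).trans_lt ?_
  have := h (x - y) (by simpa [dist_eq_norm] using hxy)
  simp only [zero_add, sub_self, norm_zero, integral_zero, mul_zero, dist_zero_right] at this
  exact (le_abs_self _).trans_lt this

theorem BoundedContinuousFunction.memLp_top_volume (f : ℝ →ᵇ ℂ) : MemLp f ∞ volume :=
  memLp_top_of_bound f.continuous.aestronglyMeasurable ‖f‖ (.of_forall f.norm_coe_le_norm)

/-! ### Convolution operators on bounded continuous functions -/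

/-- Convolution with an integrable kernel, as an operator on bounded continuous functions. -/
noncomputable def convOp (k : ℝ → ℂ) (hk : Integrable k) : (ℝ →ᵇ ℂ) →L[ℂ] (ℝ →ᵇ ℂ) :=
  LinearMap.mkContinuous
    { toFun := fun f => BoundedContinuousFunction.ofNormedAddCommGroup
        (fun x => ∫ t, k t * f (x - t))
        (uniformContinuous_convolution hk f.memLp_top_volume).continuous
        (‖f‖ * ∫ t, ‖k t‖)
        (norm_convolution_le hk f.memLp_top_volume (.of_forall f.norm_coe_le_norm))
      map_add' := fun f g => by
        ext x
        simp only [BoundedContinuousFunction.coe_add, Pi.add_apply, mul_add,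
          BoundedContinuousFunction.coe_ofNormedAddCommGroup]
        exact integral_add (hk.mul_translate_memLp_top f.memLp_top_volume x)
          (hk.mul_translate_memLp_top g.memLp_top_volume x)
      map_smul' := fun c f => by
        ext x
        simp only [BoundedContinuousFunction.coe_smul, smul_eq_mul, RingHom.id_apply,
          BoundedContinuousFunction.coe_ofNormedAddCommGroup, mul_left_comm _ c]
        exact integral_const_mul _ _ }
    (∫ t, ‖k t‖) fun f => by
      rw [mul_comm]
      exact BoundedContinuousFunction.norm_ofNormedAddCommGroup_le _
        (mul_nonneg (norm_nonneg f) (integral_nonneg fun t => norm_nonneg (k t)))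
        (norm_convolution_le hk f.memLp_top_volume (.of_forall f.norm_coe_le_norm))

theorem convOp_apply {k : ℝ → ℂ} (hk : Integrable k) (f : ℝ →ᵇ ℂ) (x : ℝ) :
    convOp k hk f x = ∫ t, k t * f (x - t) := rfl

theorem convOp_mem (k : ℝ → ℂ) (hk : Integrable k) (f : ℝ →ᵇ ℂ) :
    convOp k hk f ∈ BoundedUniformlyContinuous :=
  uniformContinuous_convolution hk f.memLp_top_volume

theorem integrable_mul_mul_translate {k h : ℝ → ℂ} (hk : Integrable k) (hh : Integrable h)
    (f : ℝ →ᵇ ℂ) (x : ℝ) :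
    Integrable (fun p : ℝ × ℝ => k p.1 * h p.2 * f (x - p.1 - p.2)) (volume.prod volume) :=
  (hk.mul_prod hh).mul_bdd (by fun_prop) (.of_forall fun _ => f.norm_coe_le_norm _)

theorem convOp_commute {k h : ℝ → ℂ} (hk : Integrable k) (hh : Integrable h) :
    Commute (convOp k hk) (convOp h hh) := by
  ext f x
  have hswap := integral_integral_swap (f := fun t s => k t * h s * f (x - t - s))
    (integrable_mul_mul_translate hk hh f x)
  simp only [_root_.mul_apply_eq_comp, convOp_apply, ← integral_const_mul]
  calc _ = ∫ t, ∫ s, k t * h s * f (x - t - s) := by simp only [mul_assoc]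
    _ = _ := hswap
    _ = _ := by
      congr 1 with s
      congr 1 with t
      rw [sub_right_comm]
      ring

/-! ### Frequency localization by modulated dilates -/

/-- The complex number `e^{2πix}`. -/
noncomputable def unitExp (x : ℝ) : ℂ := Circle.coeHom (𝐞 x)

theorem unitExp_add (x y : ℝ) : unitExp (x + y) = unitExp x * unitExp y := by
  simp [unitExp, AddChar.map_add_eq_mul]

theorem norm_unitExp (x : ℝ) : ‖unitExp x‖ = 1 := Circle.norm_coe _

@[fun_prop]
theorem continuous_unitExp : Continuous unitExp :=
  continuous_subtype_val.comp Real.continuous_fourierChar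

theorem fourier_eq_integral_unitExp (f : ℝ → ℂ) (t : ℝ) :
    𝓕 f t = ∫ x, unitExp (-(x * t)) * f x := Real.fourier_real_eq f t

theorem fourierInv_eq_integral_unitExp (f : ℝ → ℂ) (x : ℝ) :
    𝓕⁻ f x = ∫ t, unitExp (t * x) * f t := by
  rw [Real.fourierInv_eq]
  congr 1 with t
  rw [Circle.smul_def, smul_eq_mul, real_inner_comm]
  simp only [RCLike.inner_apply, conj_trivial]
  rfl

/-- The function `x ↦ e^{2πiax} δ V(δx)`, whose Fourier transform is `t ↦ 𝓕 V ((t - a) / δ)`. -/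
noncomputable def modDilate (V : ℝ → ℂ) (a δ : ℝ) (x : ℝ) : ℂ :=
  unitExp (a * x) * (δ * V (δ * x))

theorem MeasureTheory.Integrable.modDilate {V : ℝ → ℂ} (hV : Integrable V) (a : ℝ) {δ : ℝ}
    (hδ : 0 < δ) : Integrable (modDilate V a δ) := by
  refine ((hV.comp_mul_left' hδ.ne').const_mul (δ : ℂ)).bdd_mul (c := 1) ?_ ?_
  · exact (by fun_prop : Continuous fun x => unitExp (a * x)).aestronglyMeasurable
  · exact .of_forall fun x => (norm_unitExp _).le

theorem Continuous.modDilate {V : ℝ → ℂ} (hV : Continuous V) (a δ : ℝ) :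
    Continuous (modDilate V a δ) := by
  unfold _root_.modDilate
  fun_prop

theorem integral_mul_comp_mul_left {E : Type*} [NormedAddCommGroup E] [NormedSpace ℝ E]
    (g : ℝ → E) {δ : ℝ} (hδ : 0 < δ) : ∫ x, δ • g (δ * x) = ∫ x, g x := by
  rw [integral_smul, Measure.integral_comp_mul_left, smul_smul, abs_of_pos (inv_pos.2 hδ),
    mul_inv_cancel₀ hδ.ne', one_smul]

theorem fourier_modDilate (V : ℝ → ℂ) (a : ℝ) {δ : ℝ} (hδ : 0 < δ) (t : ℝ) :
    𝓕 (modDilate V a δ) t = 𝓕 V ((t - a) / δ) := by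
  rw [fourier_eq_integral_unitExp, fourier_eq_integral_unitExp]
  refine Eq.trans ?_ (integral_mul_comp_mul_left _ hδ)
  congr 1 with x
  have h : -(δ * x * ((t - a) / δ)) = -(x * t) + a * x := by field_simp; ring
  rw [h, unitExp_add, modDilate, Complex.real_smul]
  ring

theorem integral_norm_modDilate_translate (V : ℝ → ℂ) (a : ℝ) {δ : ℝ} (hδ : 0 < δ) (t : ℝ) :
    ∫ y, ‖modDilate V a δ (-t + y) - unitExp (-(t * a)) * modDilate V a δ y‖ =
      ∫ y, ‖V (-(δ * t) + y) - V y‖ := by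
  refine Eq.trans ?_ (integral_mul_comp_mul_left _ hδ)
  congr 1 with y
  have h1 : a * (-t + y) = -(t * a) + a * y := by ring
  have h2 : δ * (-t + y) = -(δ * t) + δ * y := by ring
  simp only [modDilate, h1, h2, unitExp_add]
  rw [mul_assoc, ← mul_sub, ← mul_sub, ← mul_sub]
  simp [norm_unitExp, abs_of_pos hδ]

theorem norm_convOp_translate_sub_le {V : ℝ → ℂ} (hV : Integrable V) (f : ℝ →ᵇ ℂ) (c : ℂ)
    (x t : ℝ) :
    ‖convOp V hV f (x - t) - c * convOp V hV f x‖ ≤ ‖f‖ * ∫ y, ‖V (-t + y) - c * V y‖ := by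
  have hs : Integrable fun y => V (-t + y) := hV.comp_add_left _
  have h : ∫ s, V s * f (x - t - s) = ∫ y, V (-t + y) * f (x - y) := by
    rw [← integral_add_left_eq_self (fun s => V s * f (x - t - s)) (-t)]
    congr 1 with s
    congr 2
    ring
  rw [convOp_apply, convOp_apply, h, ← integral_const_mul, ← integral_sub
    (hs.mul_translate_memLp_top f.memLp_top_volume x)
    ((hV.mul_translate_memLp_top f.memLp_top_volume x).const_mul c)]
  simp_rw [← mul_assoc, ← sub_mul]
  exact norm_convolution_le (hs.sub (hV.const_mul c)) f.memLp_top_volume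
    (.of_forall f.norm_coe_le_norm) x

/-- Translating `W = modDilate V a δ` by `t` nearly multiplies it by `e^{-2πita}`, with an L¹ error
equal to that of translating `V` by `δt`. Integrating against `k t` turns these phases into `𝓕 k a`.
The bound tends to `0` with `δ`. -/
theorem norm_convOp_modDilate_le {k V : ℝ → ℂ} (hk : Integrable k) (hV : Integrable V)
    (a : ℝ) {δ : ℝ} (hδ : 0 < δ) :
    ‖convOp k hk * convOp _ (hV.modDilate a hδ) - 𝓕 k a • convOp _ (hV.modDilate a hδ)‖ ≤
      ∫ t, ‖k t‖ * ∫ y, ‖V (-(δ * t) + y) - V y‖ := by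
  set W := modDilate V a δ
  set hW : Integrable W := hV.modDilate a hδ
  have hmeas : Continuous fun t : ℝ => ∫ y, ‖V (-(δ * t) + y) - V y‖ :=
    (continuous_integral_norm_translate_sub hV).comp (by fun_prop)
  have hint : Integrable fun t => ‖k t‖ * ∫ y, ‖V (-(δ * t) + y) - V y‖ := by
    refine hk.norm.mul_bdd (c := 2 * ∫ x, ‖V x‖) hmeas.aestronglyMeasurable
      (.of_forall fun t => ?_)
    rw [Real.norm_of_nonneg (integral_nonneg fun _ => norm_nonneg _)]
    exact integral_norm_translate_sub_le hV _
  have he : Continuous fun t : ℝ => unitExp (-(t * a)) := by fun_prop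
  have hke : Integrable fun t => unitExp (-(t * a)) * k t :=
    hk.bdd_mul (c := 1) he.aestronglyMeasurable (.of_forall fun x => (norm_unitExp _).le)
  refine ContinuousLinearMap.opNorm_le_bound _ (integral_nonneg fun t => mul_nonneg
    (norm_nonneg _) (integral_nonneg fun _ => norm_nonneg _)) fun f => ?_
  refine (BoundedContinuousFunction.norm_le (mul_nonneg (integral_nonneg fun t => mul_nonneg
    (norm_nonneg _) (integral_nonneg fun _ => norm_nonneg _)) (norm_nonneg _))).2 fun x => ?_
  have hdiff : (convOp k hk * convOp W hW - 𝓕 k a • convOp W hW) f x =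
      ∫ t, k t * (convOp W hW f (x - t) - unitExp (-(t * a)) * convOp W hW f x) := by
    have h1 : (convOp k hk * convOp W hW - 𝓕 k a • convOp W hW) f x =
      (∫ t, k t * convOp W hW f (x - t)) - 𝓕 k a * convOp W hW f x := rfl
    rw [h1, fourier_eq_integral_unitExp, ← integral_mul_const, ← integral_sub
      (hk.mul_translate_memLp_top (convOp W hW f).memLp_top_volume x) (hke.mul_const _)]
    congr 1 with t
    ring
  rw [hdiff, mul_comm, ← integral_const_mul]
  refine norm_integral_le_of_norm_le (hint.const_mul _) (.of_forall fun t => ?_)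
  rw [norm_mul, ← integral_norm_modDilate_translate V a hδ t, mul_left_comm]
  gcongr
  exact norm_convOp_translate_sub_le hW f _ x t

theorem tendsto_integral_norm_mul_translate {k V : ℝ → ℂ} (hk : Integrable k)
    (hV : Integrable V) :
    Tendsto (fun δ : ℝ => ∫ t, ‖k t‖ * ∫ y, ‖V (-(δ * t) + y) - V y‖) (𝓝 0) (𝓝 0) := by
  have hc := continuous_integral_norm_translate_sub hV
  have h0 : ∫ t : ℝ, ‖k t‖ * ∫ y, ‖V (-((0 : ℝ) * t) + y) - V y‖ = 0 := by simp
  conv => enter [3]; rw [← h0]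
  refine tendsto_integral_filter_of_dominated_convergence
    (fun t => ‖k t‖ * (2 * ∫ x, ‖V x‖)) (.of_forall fun δ => ?_) (.of_forall fun δ =>
      .of_forall fun t => ?_) (hk.norm.mul_const _) (.of_forall fun t => ?_)
  · exact hk.norm.1.mul (hc.comp (by fun_prop : Continuous fun t : ℝ => -(δ * t))).aestronglyMeasurable
  · rw [Real.norm_of_nonneg (mul_nonneg (norm_nonneg _) (integral_nonneg fun _ => norm_nonneg _))]
    gcongr
    exact integral_norm_translate_sub_le hV _
  · exact ((hc.comp (by fun_prop : Continuous fun δ : ℝ => -(δ * t))).const_mul ‖k t‖).tendsto 0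

/-- By Fubini, `V * 𝓕⁻ u = 𝓕⁻ (𝓕 V · u) = 𝓕⁻ u`; associativity of convolution carries this over to
operators. -/
theorem convOp_mul_convOp_fourierInv {V u : ℝ → ℂ} (hV : Integrable V) (hu : Integrable u)
    (hu' : Integrable (𝓕⁻ u)) (h : ∀ t, 𝓕 V t * u t = u t) :
    convOp V hV * convOp (𝓕⁻ u) hu' = convOp (𝓕⁻ u) hu' := by
  have key : ∀ y, ∫ s, V s * 𝓕⁻ u (y - s) = 𝓕⁻ u y := by
    intro y
    have he : Continuous fun p : ℝ × ℝ => unitExp (p.2 * (y - p.1)) := by fun_prop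
    have hint : Integrable (fun p : ℝ × ℝ => unitExp (p.2 * (y - p.1)) * (V p.1 * u p.2))
        (volume.prod volume) :=
      (hV.mul_prod hu).bdd_mul (c := 1) he.aestronglyMeasurable
        (.of_forall fun x => (norm_unitExp _).le)
    calc ∫ s, V s * 𝓕⁻ u (y - s) = ∫ s, ∫ t, unitExp (t * (y - s)) * (V s * u t) := by
          congr 1 with s
          rw [fourierInv_eq_integral_unitExp, ← integral_const_mul]
          congr 1 with t
          ring
      _ = ∫ t, ∫ s, unitExp (t * (y - s)) * (V s * u t) := integral_integral_swap hint
      _ = ∫ t, unitExp (t * y) * u t := by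
          congr 1 with t
          conv_rhs => rw [← h t]
          rw [fourier_eq_integral_unitExp, ← integral_mul_const, ← integral_const_mul]
          congr 1 with s
          have : t * (y - s) = t * y + -(s * t) := by ring
          rw [this, unitExp_add]
          ring
      _ = 𝓕⁻ u y := (fourierInv_eq_integral_unitExp u y).symm
  ext f x
  rw [_root_.mul_apply_eq_comp, convOp_apply, convOp_apply]
  simp only [convOp_apply]
  calc ∫ t, V t * ∫ s, 𝓕⁻ u s * f (x - t - s)
      = ∫ t, ∫ s, V t * 𝓕⁻ u (s - t) * f (x - s) := by
        congr 1 with t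
        rw [← integral_const_mul, ← integral_sub_right_eq_self _ t]
        congr 1 with s
        rw [mul_assoc]
        congr 3
        ring
    _ = ∫ s, ∫ t, V t * 𝓕⁻ u (s - t) * f (x - s) := by
        refine integral_integral_swap ?_
        have := (hV.convolution_integrand (ContinuousLinearMap.mul ℂ ℂ) hu').swap
        exact this.mul_bdd (c := ‖f‖) (by fun_prop) (.of_forall fun _ => f.norm_coe_le_norm _)
    _ = ∫ s, 𝓕⁻ u s * f (x - s) := by
        congr 1 with s
        rw [integral_mul_const, key]

/-! ### Kernels with smooth compactly supported Fourier transform -/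

section TestFunctions

variable {u : ℝ → ℂ}

theorem HasCompactSupport.integrable_fourierInv (hc : HasCompactSupport u)
    (hu : ContDiff ℝ ∞ u) : Integrable (𝓕⁻ u) := by
  have h := (𝓕⁻ (hc.toSchwartzMap hu)).integrable (μ := volume)
  rwa [SchwartzMap.fourierInv_coe] at h

theorem HasCompactSupport.integrable_fourier (hc : HasCompactSupport u)
    (hu : ContDiff ℝ ∞ u) : Integrable (𝓕 u) :=
  (𝓕 (hc.toSchwartzMap hu)).integrable

theorem HasCompactSupport.continuous_fourierInv (hc : HasCompactSupport u)
    (hu : ContDiff ℝ ∞ u) : Continuous (𝓕⁻ u) := by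
  have h := (𝓕⁻ (hc.toSchwartzMap hu)).continuous
  rwa [SchwartzMap.fourierInv_coe] at h

theorem HasCompactSupport.fourier_fourierInv_eq (hc : HasCompactSupport u)
    (hu : ContDiff ℝ ∞ u) : 𝓕 (𝓕⁻ u) = u :=
  hu.continuous.fourier_fourierInv_eq (hu.continuous.integrable_of_hasCompactSupport hc)
    (hc.integrable_fourier hu)

end TestFunctions

/-- There is an integrable kernel of de la Vallée-Poussin type: its Fourier transform is a test
function equal to `1` near `0`. -/
theorem exists_integrable_fourier_eq_one : ∃ V : ℝ → ℂ, Continuous V ∧ Integrable V ∧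
    ContDiff ℝ ∞ (𝓕 V) ∧ HasCompactSupport (𝓕 V) ∧ ∀ t, |t| ≤ 1 → 𝓕 V t = 1 := by
  let θ : ContDiffBump (0 : ℝ) := ⟨1, 2, one_pos, one_lt_two⟩
  let u : ℝ → ℂ := fun t => (θ t : ℂ)
  have hu : ContDiff ℝ ∞ u := Complex.ofRealCLM.contDiff.comp θ.contDiff
  have hc : HasCompactSupport u := θ.hasCompactSupport.comp_left Complex.ofReal_zero
  refine ⟨𝓕⁻ u, hc.continuous_fourierInv hu, hc.integrable_fourierInv hu, ?_⟩
  rw [hc.fourier_fourierInv_eq hu]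
  refine ⟨hu, hc, fun t ht => ?_⟩
  have : θ t = 1 := θ.one_of_mem_closedBall (by simpa [θ] using ht)
  simp [u, this]

/-! ### Wiener's division lemma -/

/-- If `A B` is close to `c B`, then `A` can be divided into everything on which `B` acts as the
identity. -/
theorem exists_mul_eq_of_norm_sub_smul_lt {R : Type*} [NormedRing R] [NormedAlgebra ℂ R]
    [HasSummableGeomSeries R] {a b p : R} {c : ℂ} (hab : Commute a b) (hbp : b * p = p)
    (hc : ‖a * b - c • b‖ < ‖c‖) : ∃ q : R, a * (q * p) = p := by
  have hc0 : c ≠ 0 := norm_pos_iff.1 ((norm_nonneg _).trans_lt hc)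
  have hlt : ‖-(c⁻¹ • (a * b - c • b))‖ < 1 := by
    rw [norm_neg, norm_smul, norm_inv, inv_mul_lt_iff₀ (norm_pos_iff.2 hc0), mul_one]
    exact hc
  obtain ⟨U, hU⟩ := isUnit_one_sub_of_norm_lt_one hlt
  -- Wherever `b` acts as the identity, the right-hand side acts as `a`; so `a` can be inverted
  -- there by inverting `c • U`.
  have hU' : c • (U : R) = c • (1 : R) + (a * b - c • b) := by
    rw [hU, sub_neg_eq_add, smul_add, smul_smul, mul_inv_cancel₀ hc0, one_smul]
  have hbU : Commute b (U : R) := by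
    rw [hU]
    refine (Commute.one_right b).sub_right (Commute.neg_right (Commute.smul_right ?_ _))
    exact (hab.symm.mul_right (Commute.refl b)).sub_right ((Commute.refl b).smul_right c)
  have hbU' : b * (↑U⁻¹ : R) = (↑U⁻¹ : R) * b := hbU.units_inv_right
  refine ⟨c⁻¹ • (↑U⁻¹ : R), ?_⟩
  set q : R := c⁻¹ • (↑U⁻¹ : R) * p
  have hbq : b * q = q := by
    simp only [q]
    rw [← mul_assoc, mul_smul_comm, hbU', smul_mul_assoc, smul_mul_assoc, mul_assoc, hbp]
  have hUq : c • (U : R) * q = p := by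
    simp only [q]
    rw [← mul_assoc, smul_mul_smul_comm, mul_inv_cancel₀ hc0, one_smul, Units.mul_inv, one_mul]
  calc a * q = a * (b * q) := by rw [hbq]
    _ = (c • (1 : R) + (a * b - c • b)) * q := by
      rw [add_mul, sub_mul, smul_mul_assoc, one_mul, smul_mul_assoc, hbq, mul_assoc, hbq]
      abel
    _ = p := by rw [← hU', hUq]

/-- Convolution with `k` hits everything in the image of convolution with `h`. -/
def ConvDivides (k h : ℝ → ℂ) : Prop :=
  ∀ (hk : Integrable k) (hh : Integrable h) (g : ℝ →ᵇ ℂ), ∃ f, convOp k hk f = convOp h hh g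

/-- The radius is the dilation parameter `δ`: the transform of `modDilate V a δ` is `1` on the ball
of radius `δ` about `a`, so this kernel fixes `𝓕⁻ u`. -/
theorem exists_pos_convDivides {k : ℝ → ℂ} (hk : Integrable k) {a : ℝ} (ha : 𝓕 k a ≠ 0) :
    ∃ r > 0, ∀ u : ℝ → ℂ, ContDiff ℝ ∞ u → HasCompactSupport u →
      Function.support u ⊆ Metric.ball a r → ConvDivides k (𝓕⁻ u) := by
  obtain ⟨V, -, hV, -, -, hV1⟩ := exists_integrable_fourier_eq_one
  have hev := (tendsto_integral_norm_mul_translate hk hV).eventually_lt_const (norm_pos_iff.2 ha)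
  obtain ⟨δ, hlt, hδ⟩ := ((hev.filter_mono nhdsWithin_le_nhds).and
    (self_mem_nhdsWithin : Set.Ioi (0 : ℝ) ∈ 𝓝[>] 0)).exists
  refine ⟨δ, hδ, fun u hu hc hsupp _ hh g => ?_⟩
  have hW := hV.modDilate a hδ
  have hbp : convOp _ hW * convOp (𝓕⁻ u) hh = convOp (𝓕⁻ u) hh := by
    refine convOp_mul_convOp_fourierInv hW (hu.continuous.integrable_of_hasCompactSupport hc)
      hh fun t => ?_
    by_cases ht : u t = 0
    · rw [ht, mul_zero]
    · have hta : |t - a| < δ := hsupp ht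
      rw [fourier_modDilate V a hδ, hV1, one_mul]
      rw [abs_div, abs_of_pos hδ, div_le_one hδ]
      exact hta.le
  obtain ⟨q, hq⟩ := exists_mul_eq_of_norm_sub_smul_lt
    (R := (ℝ →ᵇ ℂ) →L[ℂ] (ℝ →ᵇ ℂ)) (convOp_commute hk hW) hbp
    ((norm_convOp_modDilate_le hk hV a hδ).trans_lt hlt)
  exact ⟨(q * convOp (𝓕⁻ u) hh) g, DFunLike.congr_fun hq g⟩

theorem ConvDivides.fourierInv_add {k u v : ℝ → ℂ} (hu : Integrable u) (hv : Integrable v)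
    (hu' : Integrable (𝓕⁻ u)) (hv' : Integrable (𝓕⁻ v))
    (h₁ : ConvDivides k (𝓕⁻ u)) (h₂ : ConvDivides k (𝓕⁻ v)) :
    ConvDivides k (𝓕⁻ (u + v)) := by
  intro hk hh g
  obtain ⟨f₁, hf₁⟩ := h₁ hk hu' g
  obtain ⟨f₂, hf₂⟩ := h₂ hk hv' g
  refine ⟨f₁ + f₂, ?_⟩
  have hadd : ∀ x, 𝓕⁻ (u + v) x = 𝓕⁻ u x + 𝓕⁻ v x := fun x => by
    have hint : ∀ {w : ℝ → ℂ}, Integrable w → Integrable fun t => unitExp (t * x) * w t :=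
      fun hw => hw.bdd_mul (c := 1)
        (by fun_prop : Continuous fun t => unitExp (t * x)).aestronglyMeasurable
        (.of_forall fun t => (norm_unitExp _).le)
    rw [fourierInv_eq_integral_unitExp, fourierInv_eq_integral_unitExp,
      fourierInv_eq_integral_unitExp, ← integral_add (hint hu) (hint hv)]
    simp only [Pi.add_apply, mul_add]
  rw [map_add, hf₁, hf₂]
  ext x
  rw [BoundedContinuousFunction.add_apply, convOp_apply, convOp_apply, convOp_apply,
    ← integral_add (hu'.mul_translate_memLp_top g.memLp_top_volume x)
      (hv'.mul_translate_memLp_top g.memLp_top_volume x)]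
  simp only [hadd, add_mul]

/-- Induction peels off one ball at a time. Covering by half-radius balls leaves room for a cutoff
`w` that is `1` on the half ball and supported in the full one: `w * u` is local, and `(1 - w) * u`
vanishes on the half ball. -/
theorem convDivides_of_support_subset_biUnion {k : ℝ → ℂ} (r : ℝ → ℝ) (hr : ∀ a, 0 < r a)
    (h : ∀ a, ∀ u : ℝ → ℂ, ContDiff ℝ ∞ u → HasCompactSupport u →
      Function.support u ⊆ Metric.ball a (r a) → ConvDivides k (𝓕⁻ u)) (s : Finset ℝ) :
    ∀ u : ℝ → ℂ, ContDiff ℝ ∞ u → HasCompactSupport u →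
      Function.support u ⊆ ⋃ a ∈ s, Metric.ball a (r a / 2) → ConvDivides k (𝓕⁻ u) := by
  classical
  induction s using Finset.induction_on with
  | empty =>
    intro u hu hc hs
    refine h 0 u hu hc (hs.trans ?_)
    simp
  | insert a s _ ih =>
    intro u hu hc hs
    let θ : ContDiffBump a := ⟨r a / 2, r a, half_pos (hr a), half_lt_self (hr a)⟩
    let w : ℝ → ℂ := fun t => (θ t : ℂ)
    have hw : ContDiff ℝ ∞ w := Complex.ofRealCLM.contDiff.comp θ.contDiff
    have h1 : ContDiff ℝ ∞ (w * u) := hw.mul hu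
    have h2 : ContDiff ℝ ∞ ((1 - w) * u) := (contDiff_const.sub hw).mul hu
    have hc1 : HasCompactSupport (w * u) := hc.mul_left
    have hc2 : HasCompactSupport ((1 - w) * u) := hc.mul_left
    have hdec : u = w * u + (1 - w) * u := by ring
    have d1 : ConvDivides k (𝓕⁻ (w * u)) := by
      refine h a _ h1 hc1 fun t ht => ?_
      have : θ t ≠ 0 := fun h0 => ht (by simp [w, h0])
      rw [← Function.mem_support, θ.support_eq] at this
      exact this
    have d2 : ConvDivides k (𝓕⁻ ((1 - w) * u)) := by
      refine ih _ h2 hc2 fun t ht => ?_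
      have hut : t ∈ Function.support u := fun h0 => ht (by simp [h0])
      have hta : t ∉ Metric.ball a (r a / 2) := fun h0 => ht (by
        have : θ t = 1 := θ.one_of_mem_closedBall (Metric.ball_subset_closedBall h0)
        simp [w, this])
      have := hs hut
      rw [Finset.set_biUnion_insert] at this
      exact this.resolve_left hta
    rw [hdec]
    exact d1.fourierInv_add (h1.continuous.integrable_of_hasCompactSupport hc1)
      (h2.continuous.integrable_of_hasCompactSupport hc2) (hc1.integrable_fourierInv h1)
      (hc2.integrable_fourierInv h2) d2

/-- **Wiener's division lemma**. -/
theorem convDivides_fourierInv {k : ℝ → ℂ} (hk : Integrable k) (hW : ∀ t : ℝ, 𝓕 k t ≠ 0)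
    {u : ℝ → ℂ} (hu : ContDiff ℝ ∞ u) (hc : HasCompactSupport u) : ConvDivides k (𝓕⁻ u) := by
  choose r hr h using fun a => exists_pos_convDivides hk (hW a)
  obtain ⟨s, -, hs⟩ := hc.isCompact.elim_nhds_subcover (fun a => Metric.ball a (r a / 2))
    fun a _ => Metric.ball_mem_nhds a (half_pos (hr a))
  exact convDivides_of_support_subset_biUnion r hr h s u hu hc
    ((subset_tsupport u).trans hs)

/-! ### Approximate identity -/

theorem convOp_modDilate_zero_apply {V : ℝ → ℂ} (hV : Integrable V) {δ : ℝ} (hδ : 0 < δ)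
    (g : ℝ →ᵇ ℂ) (x : ℝ) :
    convOp _ (hV.modDilate 0 hδ) g x = ∫ y, V y * g (x - δ⁻¹ * y) := by
  rw [convOp_apply]
  refine Eq.trans ?_ (integral_mul_comp_mul_left (fun y => V y * g (x - δ⁻¹ * y)) hδ)
  congr 1 with t
  rw [modDilate, zero_mul, Complex.real_smul, inv_mul_cancel_left₀ hδ.ne']
  simp [unitExp, mul_assoc]

/-- A modulus bound that is uniform in `x`, bounded and continuous in `s`, as dominated convergence
requires. -/
theorem UniformContinuous.exists_norm_sub_le {g : ℝ →ᵇ ℂ} (hg : UniformContinuous g) {ε : ℝ}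
    (hε : 0 < ε) : ∃ M : ℝ, 0 ≤ M ∧ ∀ x s : ℝ, ‖g (x - s) - g x‖ ≤ ε + 2 * ‖g‖ * min 1 (M * |s|) := by
  obtain ⟨η, hη, h⟩ := Metric.uniformContinuous_iff.1 hg ε hε
  refine ⟨η⁻¹, by positivity, fun x s => ?_⟩
  rcases lt_or_ge |s| η with hs | hs
  · have h1 : ‖g (x - s) - g x‖ < ε := by
      rw [← dist_eq_norm]
      exact h (by simpa [dist_eq_norm] using hs)
    have : 0 ≤ 2 * ‖g‖ * min 1 (η⁻¹ * |s|) := by positivity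
    linarith
  · have h1 : ‖g (x - s) - g x‖ ≤ ‖g‖ + ‖g‖ :=
      (norm_sub_le _ _).trans (add_le_add (g.norm_coe_le_norm _) (g.norm_coe_le_norm _))
    rw [min_eq_left (by rwa [inv_mul_eq_div, one_le_div hη])]
    linarith

theorem exists_norm_convOp_modDilate_sub_lt {V : ℝ → ℂ} (hV : Integrable V) (hV1 : ∫ x, V x = 1)
    {g : ℝ →ᵇ ℂ} (hg : UniformContinuous g) {ε : ℝ} (hε : 0 < ε) :
    ∃ δ : ℝ, ∃ hδ : 0 < δ, ‖convOp _ (hV.modDilate 0 hδ) g - g‖ < ε := by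
  set I := ∫ x, ‖V x‖
  have hI : 0 ≤ I := integral_nonneg fun _ => norm_nonneg _
  obtain ⟨M, hM0, hM⟩ := hg.exists_norm_sub_le (ε := ε / (2 * (I + 1))) (by positivity)
  set e := ε / (2 * (I + 1))
  let F : ℝ → ℝ → ℝ := fun τ y => ‖V y‖ * (e + 2 * ‖g‖ * min 1 (M * |τ * y|))
  have hFle : ∀ τ y, ‖F τ y‖ ≤ ‖V y‖ * (e + 2 * ‖g‖) := fun τ y => by
    have he : 0 ≤ e := by positivity
    rw [Real.norm_of_nonneg (by positivity)]
    have : 2 * ‖g‖ * min 1 (M * |τ * y|) ≤ 2 * ‖g‖ :=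
      mul_le_of_le_one_right (by positivity) (min_le_left _ _)
    exact mul_le_mul_of_nonneg_left (by linarith) (norm_nonneg _)
  have hFm : ∀ τ, AEStronglyMeasurable (F τ) := fun τ =>
    hV.norm.1.mul (by fun_prop : Continuous fun y : ℝ =>
      e + 2 * ‖g‖ * min 1 (M * |τ * y|)).aestronglyMeasurable
  have hF : ∀ τ, Integrable (F τ) := fun τ =>
    (hV.norm.mul_const _).mono' (hFm τ) (.of_forall (hFle τ))
  have hlim : Tendsto (fun τ => ∫ y, F τ y) (𝓝 0) (𝓝 (I * e)) := by
    rw [← integral_mul_const]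
    refine tendsto_integral_filter_of_dominated_convergence _ (.of_forall hFm)
      (.of_forall fun τ => .of_forall (hFle τ)) (hV.norm.mul_const _) (.of_forall fun y => ?_)
    have hcont : Continuous fun τ => F τ y := by fun_prop
    have h0 : F 0 y = ‖V y‖ * e := by simp [F]
    exact h0 ▸ hcont.tendsto 0
  have hIe : I * e < ε := by
    simp only [e]
    rw [mul_div_assoc', div_lt_iff₀ (by positivity)]
    nlinarith
  obtain ⟨τ, hlt, hτ⟩ := (((hlim.eventually_lt_const hIe).filter_mono nhdsWithin_le_nhds).and
    (self_mem_nhdsWithin : Set.Ioi (0 : ℝ) ∈ 𝓝[>] 0)).exists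
  -- Small `τ` means a large dilation factor, concentrating the kernel at `0`.
  refine ⟨τ⁻¹, inv_pos.2 hτ, lt_of_le_of_lt ?_ hlt⟩
  refine (BoundedContinuousFunction.norm_le_of_nonempty).2 fun x => ?_
  have hg' : Integrable fun y => V y * g (x - τ * y) :=
    hV.mul_bdd (c := ‖g‖) (by fun_prop) (.of_forall fun _ => g.norm_coe_le_norm _)
  rw [BoundedContinuousFunction.sub_apply, convOp_modDilate_zero_apply hV (inv_pos.2 hτ), inv_inv]
  have : g x = ∫ y, V y * g x := by rw [integral_mul_const, hV1, one_mul]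
  rw [this, ← integral_sub hg' (hV.mul_const _)]
  refine norm_integral_le_of_norm_le (hF τ) (.of_forall fun y => ?_)
  rw [← mul_sub, norm_mul]
  exact mul_le_mul_of_nonneg_left (hM x _) (norm_nonneg _)

end WienerTauberian

theorem mainTheorem5 (k : ℝ → ℂ) (hk : Integrable k volume) (hW : ∀ t : ℝ, 𝓕 k t ≠ 0) :
    (∀ f : ℝ → ℂ, MemLp f ∞ volume →
      ConvolutionExists k f (ContinuousLinearMap.mul ℂ ℂ) volume) ∧
    convolutionsWithBounded k ⊆
      Set.range (fun g : BoundedUniformlyContinuous => ((g : ℝ →ᵇ ℂ) : ℝ → ℂ)) ∧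
    Dense {g : BoundedUniformlyContinuous |
      ((g : ℝ →ᵇ ℂ) : ℝ → ℂ) ∈ convolutionsWithBounded k} := by
  refine ⟨fun f hf => convolutionExists_of_memLp_top hk hf, ?_, ?_⟩
  · rintro _ ⟨f, hf, rfl⟩
    obtain ⟨C, -, hC⟩ := hf.exists_ae_norm_le
    have huc := uniformContinuous_convolution hk hf
    exact ⟨⟨BoundedContinuousFunction.ofNormedAddCommGroup _ huc.continuous _
      (norm_convolution_le hk hf hC), huc⟩, rfl⟩
  · intro g
    rw [Metric.mem_closure_iff]
    intro ε hε
    obtain ⟨V, hVc, hV, hu, hc, hV1⟩ := exists_integrable_fourier_eq_one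
    -- The integral is the Fourier transform at `0`.
    have hV1' : ∫ x, V x = 1 := by
      rw [← hV1 0 (by simp), fourier_eq_integral_unitExp]
      simp [unitExp]
    obtain ⟨δ, hδ, hlt⟩ := exists_norm_convOp_modDilate_sub_lt hV hV1' g.2 hε
    set W := modDilate V 0 δ
    have hFW : 𝓕 W = fun t => 𝓕 V (δ⁻¹ * t) := by
      ext t
      rw [fourier_modDilate V 0 hδ, sub_zero, inv_mul_eq_div]
    have huW : ContDiff ℝ (⊤ : ℕ∞) (𝓕 W) := by
      rw [hFW]
      exact hu.comp (contDiff_const.mul contDiff_id)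
    have hcW : HasCompactSupport (𝓕 W) := by
      rw [hFW]
      exact hc.comp_homeomorph (Homeomorph.mulLeft₀ δ⁻¹ (inv_ne_zero hδ.ne'))
    -- Fourier inversion puts `W` in the form `𝓕⁻ u` needed for division by `k`.
    have hWW : 𝓕⁻ (𝓕 W) = W := (hVc.modDilate 0 δ).fourierInv_fourier_eq (hV.modDilate 0 hδ)
      (huW.continuous.integrable_of_hasCompactSupport hcW)
    have hdiv := convDivides_fourierInv hk hW huW hcW
    rw [hWW] at hdiv
    obtain ⟨f, hf⟩ := hdiv hk (hV.modDilate 0 hδ) g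
    refine ⟨⟨convOp k hk f, convOp_mem k hk f⟩, ⟨f, f.memLp_top_volume, rfl⟩, ?_⟩
    rw [dist_comm, Subtype.dist_eq, dist_eq_norm]
    change ‖convOp k hk f - g‖ < ε
    rw [hf]
    exact hlt
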